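/- Let $n\ge 2$ and let $L\subset\mathbf{R}^{n-1}$ be a lattice (a discrete subgroup spanning $\mathbf{R}^{n-1}$). Let $\mathbf{H}^n=\{(x,y): x\in\mathbf{R}^{n-1},\ y>0\}$ be hyperbolic $n$-space in the upper half-space model, with Riemannian metric $y^{-2}(|dx|^2+dy^2)$ of constant curvature $-1$, and let $\Gamma$ be the lattice of parabolic translations $(x,y)\mapsto(x+\ell,y)$, $\ell\in L$, whose unique fixed point on the ideal boundary is the point at infinity. The quotient Riemannian manifold $M=\mathbf{H}^n/\Gamma$ is called a complete constant curvature $n$-dimensional cusp. (Every lattice of parabolic translations of $\mathbf{H}^n$ has this form after moving its fixed point to infinity by an isometry.) A domain of $M$ is a relatively compact open subset with smooth boundary. For $v>0$, let $I_M(v)$, the isoperimetric profile, be the greatest lower bound of the $(n-1)$-dimensional Riemannian volumes $\mathrm{vol}(\partial D)$ over all domains $D\subset M$ with $\mathrm{vol}(D)=v$. Then, for all $v\in(0,+\infty)$, $$I_M(v)=(n-1)\,v.$$ -/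

import Mathlib

open MeasureTheory Topology
open scoped ContDiff ENNReal

namespace HyperbolicCusp

noncomputable section

/-- The Euclidean space `ℝ^(n-1)`: the complement of the point at infinity in the ideal boundary
of the upper half-space. -/
abbrev Horo (n : ℕ) : Type := EuclideanSpace ℝ (Fin (n - 1))

/-- The Euclidean space `ℝ^(n-1) × ℝ` (with the Euclidean inner product, of dimension `n` when
`1 ≤ n`), which contains the upper half-space. -/
abbrev Ambient (n : ℕ) : Type := WithLp 2 (Horo n × ℝ)

/-- The underlying manifold of hyperbolic `n`-space in the upper half-space model:
the points `(x, y)` with `y > 0`. -/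
abbrev UpperHalfSpace (n : ℕ) : Type := {p : Ambient n // 0 < p.snd}

/-- The hyperbolic Riemannian metric of curvature `-1`, `g_(x,y) = (|dx|² + dy²) / y²`. -/
def hyperbolicMetric {n : ℕ} (p : Ambient n) : LinearMap.BilinForm ℝ (Ambient n) :=
  (p.snd ^ 2)⁻¹ • innerₗ (Ambient n)

/-- A lattice `L` of `ℝ^(n-1)` acts on the upper half-space by the parabolic translations
`(x, y) ↦ (x + ℓ, y)`, `ℓ ∈ L`, which fix the point at infinity. -/
instance translationAction {n : ℕ} (L : Submodule ℤ (Horo n)) :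
    AddAction L (UpperHalfSpace n) where
  vadd l p := ⟨WithLp.toLp 2 ((l : Horo n) + p.1.fst, p.1.snd), p.2⟩
  zero_vadd p := Subtype.ext (by
    change WithLp.toLp 2 (((0 : L) : Horo n) + p.1.fst, p.1.snd) = p.1
    rw [ZeroMemClass.coe_zero, zero_add]; rfl)
  add_vadd l m p := Subtype.ext (by
    change WithLp.toLp 2 (((l + m : L) : Horo n) + p.1.fst, p.1.snd)
      = WithLp.toLp 2 ((l : Horo n) + ((m : Horo n) + p.1.fst), p.1.snd)
    rw [Submodule.coe_add, add_assoc])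

/-- The cusp `M = Hⁿ / Γ`, where `Γ` is the group of parabolic translations given by `L`, with the
quotient topology. Its smooth structure and its Riemannian metric are the ones for which the
projection from the upper half-space is a local isometry. -/
abbrev Cusp {n : ℕ} (L : Submodule ℤ (Horo n)) : Type :=
  AddAction.orbitRel.Quotient L (UpperHalfSpace n)

variable {n : ℕ} (L : Submodule ℤ (Horo n))

/-- The projection `Hⁿ → M`. -/
def proj (p : UpperHalfSpace n) : Cusp L := Quotient.mk'' p

/-- The full preimage in the upper half-space of a subset of the cusp. -/
def lift (S : Set (Cusp L)) : Set (Ambient n) := Subtype.val '' (proj L ⁻¹' S)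

/-- A fundamental domain for `Γ`: the points of the upper half-space that lie above a fundamental
parallelepiped of the lattice. -/
def fundDomain [DiscreteTopology L] [IsZLattice ℝ L] : Set (Ambient n) :=
  haveI : Module.Finite ℤ L := ZLattice.module_finite ℝ L
  haveI : Module.Free ℤ L := ZLattice.module_free ℝ L
  {p | p.fst ∈ ZSpan.fundamentalDomain ((Module.Free.chooseBasis ℤ L).ofZLatticeBasis ℝ L) ∧
    0 < p.snd}

/-- Each point of the cusp has exactly one representative in the fundamental domain. -/
theorem existsUnique_mem_fundDomain [DiscreteTopology L] [IsZLattice ℝ L] (x : Cusp L) :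
    ∃! p : UpperHalfSpace n, p.1 ∈ fundDomain L ∧ proj L p = x := by
  have : Module.Finite ℤ L := ZLattice.module_finite ℝ L
  have : Module.Free ℤ L := ZLattice.module_free ℝ L
  induction x using Quotient.inductionOn' with
  | h q =>
    set b := (Module.Free.chooseBasis ℤ L).ofZLatticeBasis ℝ L with hb
    have hspan : Submodule.span ℤ (Set.range b) = L := Module.Basis.ofZLatticeBasis_span ℝ L _
    obtain ⟨v, hv, huniq⟩ := ZSpan.exist_unique_vadd_mem_fundamentalDomain b q.1.fst
    have hvL : (v : Horo n) ∈ L := hspan.le v.2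
    refine ⟨(⟨v, hvL⟩ : L) +ᵥ q, ⟨⟨hv, q.2⟩, Quotient.sound' ⟨⟨v, hvL⟩, rfl⟩⟩, ?_⟩
    rintro p ⟨hp, hpq⟩
    obtain ⟨l, hl⟩ : p ∈ AddAction.orbit L q := Quotient.exact' hpq
    have hl' : (l : Horo n) ∈ Submodule.span ℤ (Set.range b) := hspan.ge l.2
    have h1 := huniq ⟨l, hl'⟩ (by
      have := hp.1
      rw [← hl] at this
      exact this)
    have h2 : (l : Horo n) = (v : Horo n) := congrArg Subtype.val h1
    rw [← hl, show l = (⟨v, hvL⟩ : L) from Subtype.ext h2]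

end

noncomputable section

/-- The tangent space at `p` of a submanifold `S` of a Euclidean space, as a linear subspace. -/
def tangentSpan {E : Type*} [NormedAddCommGroup E] [InnerProductSpace ℝ E]
    (S : Set E) (p : E) : Submodule ℝ E :=
  Submodule.span ℝ (tangentConeAt ℝ S p)

/-- The density, with respect to the Euclidean volume of `W`, of the volume defined by the
restriction to `W` of the bilinear form `g`: the square root of the determinant of `g` in a
Euclidean orthonormal basis of `W`. -/
def volumeDensity {E : Type*} [NormedAddCommGroup E] [InnerProductSpace ℝ E]
    [FiniteDimensional ℝ E] (g : LinearMap.BilinForm ℝ E) (W : Submodule ℝ E) : ℝ :=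
  Real.sqrt (Matrix.det (Matrix.of fun i j : Fin (Module.finrank ℝ W) =>
    g (stdOrthonormalBasis ℝ W i) (stdOrthonormalBasis ℝ W j)))

/-- The `k`-dimensional Riemannian volume of a `k`-dimensional submanifold `S` of the cusp
(an open subset if `k = n`, a hypersurface if `k = n - 1`): the integral, over one representative
of each point of `S`, of the Riemannian volume density of the tangent spaces of `S` with respect
to `k`-dimensional Euclidean volume (`μHE[k]`, the Hausdorff measure normalized to be Lebesgue
measure on `ℝ^k`). -/
def riemannianVolume {n : ℕ} (L : Submodule ℤ (Horo n)) [DiscreteTopology L] [IsZLattice ℝ L]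
    (k : ℕ) (S : Set (Cusp L)) : ℝ≥0∞ :=
  ∫⁻ p in lift L S ∩ fundDomain L,
    ENNReal.ofReal (volumeDensity (hyperbolicMetric p) (tangentSpan (lift L S) p)) ∂μHE[k]

/-- An open subset `D` of the cusp has smooth boundary if, near each of its boundary points
(in the local coordinates given by the projection from the upper half-space), it is the set where
a smooth function with nonzero differential is negative. -/
def HasSmoothBoundary {n : ℕ} (L : Submodule ℤ (Horo n)) (D : Set (Cusp L)) : Prop :=
  ∀ p ∈ lift L (frontier D), ∃ f : Ambient n → ℝ, ContDiff ℝ ∞ f ∧ fderiv ℝ f p ≠ 0 ∧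
    ∀ᶠ q in 𝓝 p, (q ∈ lift L D ↔ f q < 0)

/-- Domains: relatively compact open subsets with smooth boundary. -/
structure IsSmoothDomain {n : ℕ} (L : Submodule ℤ (Horo n)) (D : Set (Cusp L)) : Prop where
  isOpen : IsOpen D
  isCompact_closure : IsCompact (closure D)
  hasSmoothBoundary : HasSmoothBoundary L D

/-- The isoperimetric profile of the cusp at `v`: the greatest lower bound, in `[0, ∞]`, of the
boundary volumes of the domains of volume `v`. -/
def isoperimetricProfile {n : ℕ} (L : Submodule ℤ (Horo n)) [DiscreteTopology L] [IsZLattice ℝ L]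
    (v : ℝ) : ℝ≥0∞ :=
  ⨅ (D : Set (Cusp L)) (_ : IsSmoothDomain L D)
    (_ : riemannianVolume L n D = ENNReal.ofReal v), riemannianVolume L (n - 1) (frontier D)

end

end HyperbolicCusp

/-!
The inequality `(n - 1) vol D ≤ vol ∂D` comes from looking along the vertical lines, that is, along
the geodesics that go to the cusp. Where the vertical line over `x` meets the preimage of a domain
`D`, let `m x` be the infimum of the heights at which it does so. By relative compactness `m x > 0`,
so `(x, m x)` lies over `∂D`, and since `∫_m^∞ y⁻ⁿ dy = m¹⁻ⁿ / (n - 1)`, the part of `D` over `x`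
contributes at most `(m x)¹⁻ⁿ / (n - 1)` to `vol D = ∫∫ y⁻ⁿ dy dx`. On the other hand the area
element of a hypersurface is `y¹⁻ⁿ` times the Euclidean one, and the projection `(x, y) ↦ x` is
`1`-Lipschitz, hence does not increase `(n - 1)`-dimensional Hausdorff measure; so `∫ (m x)¹⁻ⁿ dx`
is at most the area of the lowest sheet of `∂D`. This is `mul_riemannianVolume_le`; it needs neither
a divergence theorem nor a coarea formula.

The constant is optimal because of the slabs `a < y < b`: with `A` the covolume of the lattice,
they have volume `A (a¹⁻ⁿ - b¹⁻ⁿ) / (n - 1)` and boundary area at most `A (a¹⁻ⁿ + b¹⁻ⁿ)`. At fixed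
volume `v` the area is thus at most `(n - 1) v + 2 A b¹⁻ⁿ`, and `b` may be taken arbitrarily large.

To read off the densities one needs the tangent spaces. That of an open set is everything, and that
of a smooth boundary, which is locally the zero set of the defining function `f`, is the kernel
of `df` by the implicit function theorem (`tangentConeAt_levelSet`), of dimension `n - 1`.
-/

namespace HyperbolicCusp

section

/-! ### Tangent spaces and the Riemannian volume density -/

theorem finrank_ambient {n : ℕ} (hn : 1 ≤ n) : Module.finrank ℝ (Ambient n) = n := by
  rw [(WithLp.linearEquiv 2 ℝ (Horo n × ℝ)).finrank_eq, Module.finrank_prod]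
  simp
  omega

theorem volumeDensity_hyperbolicMetric {n : ℕ} {p : Ambient n} (hp : 0 < p.snd)
    (W : Submodule ℝ (Ambient n)) :
    volumeDensity (hyperbolicMetric p) W = (p.snd ^ Module.finrank ℝ W)⁻¹ := by
  have h : (Matrix.of fun i j : Fin (Module.finrank ℝ W) =>
      hyperbolicMetric p (stdOrthonormalBasis ℝ W i) (stdOrthonormalBasis ℝ W j))
      = (p.snd ^ 2)⁻¹ • (1 : Matrix _ _ ℝ) := by
    ext i j
    have h1 := orthonormal_iff_ite.mp (stdOrthonormalBasis ℝ W).orthonormal i j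
    rw [Submodule.coe_inner] at h1
    change (p.snd ^ 2)⁻¹ * inner ℝ (stdOrthonormalBasis ℝ W i : Ambient n)
      (stdOrthonormalBasis ℝ W j : Ambient n) = _
    rw [h1]
    simp [Matrix.one_apply]
  rw [volumeDensity, h, Matrix.det_smul, Matrix.det_one, mul_one, Fintype.card_fin, inv_pow,
    ← pow_mul, mul_comm, pow_mul, ← inv_pow, Real.sqrt_sq (by positivity)]

theorem tangentSpan_of_isOpen {E : Type*} [NormedAddCommGroup E] [InnerProductSpace ℝ E]
    {S : Set E} (hS : IsOpen S) {p : E} (hp : p ∈ S) : tangentSpan S p = ⊤ := by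
  rw [tangentSpan, tangentConeAt_of_mem_nhds (hS.mem_nhds hp), Submodule.span_univ]

/-- The nontrivial inclusion holds because the implicit function theorem parametrizes the level set
near `p` by a neighbourhood of `0` in the kernel of `f'`, with the inclusion as derivative at `0`. -/
theorem tangentConeAt_levelSet {E : Type*} [NormedAddCommGroup E] [InnerProductSpace ℝ E]
    [CompleteSpace E] {f : E → ℝ} {f' : E →L[ℝ] ℝ} {p : E} (hf : HasStrictFDerivAt f f' p)
    (hf' : f' ≠ 0) :
    tangentConeAt ℝ {q | f q = f p} p = (f'.ker : Set E) := by
  apply Set.Subset.antisymm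
  · intro v hv
    have h0 : HasFDerivWithinAt f (0 : E →L[ℝ] ℝ) {q | f q = f p} p :=
      (hasFDerivWithinAt_const (f p) p _).congr (fun q hq => hq) rfl
    simpa using hf.hasFDerivAt.hasFDerivWithinAt.unique_on h0 hv
  · intro v hv
    have hr : (f' : E →ₗ[ℝ] ℝ).range = ⊤ :=
      LinearMap.range_eq_top.2
        (LinearMap.surjective fun h => hf' (ContinuousLinearMap.coe_injective h))
    have hg := (hf.to_implicitFunction hr).hasFDerivAt
    have hev : ∀ᶠ z in 𝓝 (0 : f'.ker), f (hf.implicitFunction f f' hr (f p) z) = f p :=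
      (Continuous.tendsto (f := fun z : f'.ker => (f p, z)) (by fun_prop) 0).eventually
        (hf.map_implicitFunction_eq hr)
    have hg0 : hf.implicitFunction f f' hr (f p) 0 = p :=
      hf.implicitFunction_apply_image hr
    have hmap := (hg.hasFDerivWithinAt
      (s := {z | f (hf.implicitFunction f f' hr (f p) z) = f p})).mapsTo_tangent_cone
      (show (⟨v, hv⟩ : f'.ker) ∈ _ by rw [tangentConeAt_of_mem_nhds hev]; trivial)
    rw [hg0] at hmap
    exact tangentConeAt_mono (by rintro _ ⟨z, hz, rfl⟩; exact hz) hmap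

/-- Where its differential does not vanish, a function changes sign at each of its zeros, so that
the frontier of the sublevel set is the zero set. -/
theorem eventually_mem_frontier_iff {E : Type*} [NormedAddCommGroup E] [NormedSpace ℝ E]
    {U : Set E} (hU : IsOpen U) {f : E → ℝ} (hf : ContDiff ℝ ∞ f) {p : E}
    (hp : fderiv ℝ f p ≠ 0) (hUf : ∀ᶠ q in 𝓝 p, (q ∈ U ↔ f q < 0)) :
    ∀ᶠ q in 𝓝 p, (q ∈ frontier U ↔ f q = 0) := by
  have hd : ∀ᶠ q in 𝓝 p, fderiv ℝ f q ≠ 0 :=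
    (hf.continuous_fderiv (by simp)).continuousAt.eventually_ne hp
  filter_upwards [hd, hUf.eventually_nhds] with q hq hqU
  have hqs := hqU.self_of_nhds
  rw [hU.frontier_eq, Set.mem_sdiff, hqs, not_lt]
  constructor
  · rintro ⟨h1, h2⟩
    refine le_antisymm ?_ h2
    by_contra! h3
    have h4 : ∀ᶠ r in 𝓝 q, 0 < f r := hf.continuous.continuousAt.eventually_const_lt h3
    obtain ⟨r, hr, h5, h6⟩ :=
      ((mem_closure_iff_frequently.1 h1).and_eventually (hqU.and h4)).exists
    exact absurd (h5.1 hr) h6.not_gt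
  · intro h0
    refine ⟨?_, h0.ge⟩
    rw [mem_closure_iff_frequently]
    intro hn
    refine hq (IsLocalMin.fderiv_eq_zero ?_)
    filter_upwards [hn, hqU] with r hr1 hr2
    rw [h0]
    exact not_lt.1 fun h => hr1 (hr2.2 h)

theorem finrank_tangentSpan_frontier {E : Type*} [NormedAddCommGroup E] [InnerProductSpace ℝ E]
    [FiniteDimensional ℝ E] {U S : Set E} (hU : IsOpen U) {f : E → ℝ} (hf : ContDiff ℝ ∞ f) {p : E}
    (hp : fderiv ℝ f p ≠ 0) (hUf : ∀ᶠ q in 𝓝 p, (q ∈ U ↔ f q < 0))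
    (hS : ∀ᶠ q in 𝓝 p, (q ∈ S ↔ q ∈ frontier U)) (hpS : p ∈ S) :
    Module.finrank ℝ (tangentSpan S p) = Module.finrank ℝ E - 1 := by
  have h1 : ∀ᶠ q in 𝓝 p, (q ∈ S ↔ f q = 0) := by
    filter_upwards [hS, eventually_mem_frontier_iff hU hf hp hUf] with q h1 h2
    exact h1.trans h2
  have h0 : f p = 0 := h1.self_of_nhds.1 hpS
  have h2 : 𝓝[S] p = 𝓝[{q | f q = f p}] p := by
    rw [h0]
    exact nhdsWithin_eq_iff_eventuallyEq.2 (by filter_upwards [h1] with q hq using propext hq)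
  have hst : HasStrictFDerivAt f (fderiv ℝ f p) p :=
    hf.contDiffAt.hasStrictFDerivAt (by simp)
  rw [tangentSpan, tangentConeAt_congr h2, tangentConeAt_levelSet hst hp, Submodule.span_eq]
  have h3 := (fderiv ℝ f p : E →ₗ[ℝ] ℝ).finrank_range_add_finrank_ker
  rw [LinearMap.range_eq_top.2
    (LinearMap.surjective fun h => hp (ContinuousLinearMap.coe_injective h)), finrank_top,
    Module.finrank_self] at h3
  have h4 : Module.finrank ℝ (fderiv ℝ f p).ker
    = Module.finrank ℝ (LinearMap.ker (fderiv ℝ f p : E →ₗ[ℝ] ℝ)) := rfl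
  omega

/-! ### The covering by the upper half-space -/

variable {n : ℕ} (L : Submodule ℤ (Horo n))

instance : ContinuousConstVAdd L (UpperHalfSpace n) where
  continuous_const_vadd l := by
    refine Continuous.subtype_mk ?_ _
    refine (WithLp.prod_continuous_toLp 2 _ _).comp (Continuous.prodMk ?_ ?_)
    · exact continuous_const.add ((WithLp.continuous_fst 2 _ _).comp continuous_subtype_val)
    · exact (WithLp.continuous_snd 2 _ _).comp continuous_subtype_val

theorem continuous_proj : Continuous (proj L) := continuous_quot_mk

theorem isOpenMap_proj : IsOpenMap (proj L) := isOpenMap_quotient_mk'_add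

theorem surjective_proj : Function.Surjective (proj L) := Quotient.mk''_surjective

theorem isOpen_upperHalfSpace (n : ℕ) : IsOpen {p : Ambient n | 0 < p.snd} :=
  isOpen_lt continuous_const (WithLp.continuous_snd 2 _ _)

theorem mem_lift {S : Set (Cusp L)} {p : Ambient n} :
    p ∈ lift L S ↔ ∃ hp : 0 < p.snd, proj L ⟨p, hp⟩ ∈ S := by
  constructor
  · rintro ⟨q, hq, rfl⟩
    exact ⟨q.2, hq⟩
  · rintro ⟨hp, h⟩
    exact ⟨⟨p, hp⟩, h, rfl⟩

theorem isOpen_lift {D : Set (Cusp L)} (hD : IsOpen D) : IsOpen (lift L D) :=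
  (isOpen_upperHalfSpace n).isOpenMap_subtype_val _ (hD.preimage (continuous_proj L))

theorem lift_frontier (D : Set (Cusp L)) :
    lift L (frontier D) = {p | 0 < p.snd} ∩ frontier (lift L D) := by
  have h1 := (isOpenMap_proj L).preimage_frontier_eq_frontier_preimage (continuous_proj L) D
  have h2 : (Subtype.val : UpperHalfSpace n → Ambient n) ⁻¹' frontier (lift L D)
      = frontier (Subtype.val ⁻¹' lift L D) :=
    (isOpen_upperHalfSpace n).isOpenMap_subtype_val.preimage_frontier_eq_frontier_preimage
      continuous_subtype_val (lift L D)
  nth_rw 2 [lift] at h2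
  rw [Set.preimage_image_eq _ Subtype.val_injective] at h2
  have h3 : Set.range (Subtype.val : UpperHalfSpace n → Ambient n) = {p | 0 < p.snd} :=
    Subtype.range_coe
  rw [lift, h1, ← h2, Set.image_preimage_eq_inter_range, h3, Set.inter_comm]

/-- The height `y` of a point of the cusp, which is invariant under the parabolic translations. -/
def height (L : Submodule ℤ (Horo n)) : Cusp L → ℝ :=
  Quotient.lift (fun p : UpperHalfSpace n => p.1.snd) (by rintro _ q ⟨l, rfl⟩; rfl)

theorem continuous_height : Continuous (height L) :=
  ((WithLp.continuous_snd 2 _ _).comp continuous_subtype_val).quotient_lift _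

theorem height_pos (x : Cusp L) : 0 < height L x := by
  obtain ⟨p, rfl⟩ := surjective_proj L x
  exact p.2

theorem exists_pos_le_snd_of_isCompact {K : Set (Cusp L)} (hK : IsCompact K) :
    ∃ ε > 0, ∀ p ∈ lift L K, ε ≤ p.snd := by
  rcases K.eq_empty_or_nonempty with rfl | hne
  · exact ⟨1, one_pos, fun p hp => by simp [mem_lift] at hp⟩
  · obtain ⟨x, -, hx⟩ := hK.exists_isMinOn hne (continuous_height L).continuousOn
    refine ⟨height L x, height_pos L x, fun p hp => ?_⟩
    obtain ⟨h0, h1⟩ := (mem_lift L).1 hp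
    exact hx h1

variable [DiscreteTopology L] [IsZLattice ℝ L]

/-- The fundamental parallelepiped of the lattice that defines `fundDomain`. -/
def latticeCell : Set (Horo n) :=
  haveI : Module.Finite ℤ L := ZLattice.module_finite ℝ L
  haveI : Module.Free ℤ L := ZLattice.module_free ℝ L
  ZSpan.fundamentalDomain ((Module.Free.chooseBasis ℤ L).ofZLatticeBasis ℝ L)

theorem mem_fundDomain {p : Ambient n} :
    p ∈ fundDomain L ↔ p.fst ∈ latticeCell L ∧ 0 < p.snd := Iff.rfl

theorem measurableSet_latticeCell : MeasurableSet (latticeCell L) := by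
  have : Module.Finite ℤ L := ZLattice.module_finite ℝ L
  exact ZSpan.fundamentalDomain_measurableSet _

theorem isBounded_latticeCell : Bornology.IsBounded (latticeCell L) := by
  have : Module.Finite ℤ L := ZLattice.module_finite ℝ L
  exact ZSpan.fundamentalDomain_isBounded _

theorem volume_latticeCell_ne_zero : volume (latticeCell L) ≠ 0 := by
  have : Module.Finite ℤ L := ZLattice.module_finite ℝ L
  exact ZSpan.measure_fundamentalDomain_ne_zero _

theorem volume_latticeCell_ne_top : volume (latticeCell L) ≠ ⊤ :=
  (isBounded_latticeCell L).measure_lt_top.ne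

theorem measurable_fst : Measurable (WithLp.fst : Ambient n → Horo n) :=
  (WithLp.continuous_fst 2 _ _).measurable

theorem measurable_snd : Measurable (WithLp.snd : Ambient n → ℝ) :=
  (WithLp.continuous_snd 2 _ _).measurable

theorem measurableSet_fundDomain : MeasurableSet (fundDomain L) :=
  (measurable_fst (measurableSet_latticeCell L)).inter
    (isOpen_upperHalfSpace n).measurableSet

/-- The hyperbolic volume element is `y⁻ⁿ` times the Euclidean one. -/
theorem riemannianVolume_of_isOpen (hn : 1 ≤ n) {D : Set (Cusp L)} (hD : IsOpen D) :
    riemannianVolume L n D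
      = ∫⁻ p in lift L D ∩ fundDomain L, ENNReal.ofReal ((p.snd ^ n)⁻¹) := by
  have hm : (μHE[n] : Measure (Ambient n)) = volume := by
    have := InnerProductSpace.euclideanHausdorffMeasure_eq_volume (V := Ambient n)
    rwa [finrank_ambient hn] at this
  rw [riemannianVolume, hm]
  refine setLIntegral_congr_fun
    ((isOpen_lift L hD).measurableSet.inter (measurableSet_fundDomain L)) fun p hp => ?_
  rw [volumeDensity_hyperbolicMetric hp.2.2, tangentSpan_of_isOpen (isOpen_lift L hD) hp.1,
    finrank_top, finrank_ambient hn]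

/-- The hyperbolic area element of a hypersurface is `y¹⁻ⁿ` times the Euclidean one. -/
theorem riemannianVolume_frontier (hn : 1 ≤ n) {D : Set (Cusp L)} (hD : IsSmoothDomain L D) :
    riemannianVolume L (n - 1) (frontier D)
      = ∫⁻ p in lift L (frontier D) ∩ fundDomain L,
          ENNReal.ofReal ((p.snd ^ (n - 1))⁻¹) ∂μHE[n - 1] := by
  have hmeas : MeasurableSet (lift L (frontier D)) := by
    rw [lift_frontier]
    exact (isOpen_upperHalfSpace n).measurableSet.inter isClosed_frontier.measurableSet
  rw [riemannianVolume]
  refine setLIntegral_congr_fun (hmeas.inter (measurableSet_fundDomain L)) fun p hp => ?_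
  obtain ⟨f, hf, hfp, hfD⟩ := hD.hasSmoothBoundary p hp.1
  have hS : ∀ᶠ q in 𝓝 p, (q ∈ lift L (frontier D) ↔ q ∈ frontier (lift L D)) := by
    filter_upwards [(isOpen_upperHalfSpace n).mem_nhds hp.2.2] with q hq
    rw [lift_frontier]
    exact and_iff_right hq
  beta_reduce
  rw [volumeDensity_hyperbolicMetric hp.2.2,
    finrank_tangentSpan_frontier (isOpen_lift L hD.isOpen) hf hfp hfD hS hp.1, finrank_ambient hn]

end

section

/-! ### Integration along vertical lines -/

theorem lintegral_Ioi_inv_pow {n : ℕ} (hn : 2 ≤ n) {m : ℝ} (hm : 0 < m) :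
    ∫⁻ y in Set.Ioi m, ENNReal.ofReal ((y ^ n)⁻¹)
      = ENNReal.ofReal ((m ^ (n - 1))⁻¹ / ((n : ℝ) - 1)) := by
  have hn' : (2 : ℝ) ≤ n := by exact_mod_cast hn
  have hlt : -(n : ℝ) < -1 := by linarith
  have h1 : ∀ y ∈ Set.Ioi m, (y ^ n)⁻¹ = y ^ (-(n : ℝ)) := fun y hy => by
    rw [Real.rpow_neg (hm.trans hy).le, Real.rpow_natCast]
  rw [setLIntegral_congr_fun measurableSet_Ioi fun y hy => congrArg ENNReal.ofReal (h1 y hy),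
    ← ofReal_integral_eq_lintegral_ofReal (integrableOn_Ioi_rpow_of_lt hlt hm)
      ((ae_restrict_iff' measurableSet_Ioi).2
        (.of_forall fun y hy => Real.rpow_nonneg (hm.trans hy).le _)),
    integral_Ioi_rpow_of_lt hlt hm]
  congr 1
  have h2 : -(n : ℝ) + 1 = -((n - 1 : ℕ) : ℝ) := by
    rw [Nat.cast_sub (by omega), Nat.cast_one]; ring
  rw [h2, Real.rpow_neg hm.le, Real.rpow_natCast, neg_div_neg_eq, Nat.cast_sub (by omega),
    Nat.cast_one]

variable {n : ℕ} (L : Submodule ℤ (Horo n)) [DiscreteTopology L] [IsZLattice ℝ L]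

theorem setLIntegral_inter_fundDomain {U : Set (Ambient n)} (hU : MeasurableSet U)
    {g : ℝ → ℝ≥0∞} (hg : Measurable g) :
    ∫⁻ p in U ∩ fundDomain L, g p.snd
      = ∫⁻ x in latticeCell L, ∫⁻ y in {y | 0 < y ∧ WithLp.toLp 2 (x, y) ∈ U}, g y := by
  have hUF := hU.inter (measurableSet_fundDomain L)
  have hmeas : Measurable ((U ∩ fundDomain L).indicator fun p => g p.snd) :=
    (hg.comp measurable_snd).indicator hUF
  have hmp := WithLp.volume_preserving_toLp (Horo n) ℝ
  rw [← lintegral_indicator hUF, ← hmp.lintegral_comp hmeas,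
    Measure.volume_eq_prod, lintegral_prod _ (by exact (hmeas.comp hmp.measurable).aemeasurable),
    ← lintegral_indicator (measurableSet_latticeCell L)]
  refine lintegral_congr fun x => ?_
  have hV : MeasurableSet {y : ℝ | 0 < y ∧ WithLp.toLp 2 (x, y) ∈ U} :=
    measurableSet_Ioi.inter ((hmp.measurable.comp measurable_prodMk_left) hU)
  by_cases hx : x ∈ latticeCell L
  · rw [Set.indicator_of_mem hx, ← lintegral_indicator hV]
    refine lintegral_congr fun y => ?_
    have hiff : (WithLp.toLp 2 (x, y) : Ambient n) ∈ U ∩ fundDomain L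
        ↔ y ∈ {y : ℝ | 0 < y ∧ WithLp.toLp 2 (x, y) ∈ U} :=
      ⟨fun h => ⟨h.2.2, h.1⟩, fun h => ⟨h.2, hx, h.1⟩⟩
    by_cases hy : y ∈ {y : ℝ | 0 < y ∧ WithLp.toLp 2 (x, y) ∈ U}
    · rw [Set.indicator_of_mem hy]
      exact Set.indicator_of_mem (hiff.2 hy) _
    · rw [Set.indicator_of_notMem hy]
      exact Set.indicator_of_notMem (mt hiff.1 hy) _
  · rw [Set.indicator_of_notMem hx, lintegral_eq_zero_iff (by fun_prop)]
    refine .of_forall fun y => ?_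
    simp [Set.indicator, mem_fundDomain, hx]

theorem volume_image_fst_le (s : Set (Ambient n)) :
    volume (WithLp.fst '' s) ≤ μHE[n - 1] s := by
  have hl : LipschitzWith 1 (WithLp.fst : Ambient n → Horo n) :=
    LipschitzWith.of_dist_le_mul fun p q => by
      rw [NNReal.coe_one, one_mul, dist_eq_norm, dist_eq_norm, ← WithLp.sub_fst]
      exact WithLp.norm_fst_le _ (p - q)
  rw [← EuclideanSpace.euclideanHausdorffMeasure_eq_volume,
    Measure.euclideanHausdorffMeasure_def, Measure.euclideanHausdorffMeasure_def,
    Measure.smul_apply, Measure.smul_apply]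
  refine smul_le_smul_of_nonneg_left ?_ zero_le
  simpa using hl.hausdorffMeasure_image_le (Nat.cast_nonneg (n - 1)) s

/-- If a hypersurface `S` contains the graph of `m` over `P`, then the integral over `P` of a
function of `m` is at most the integral over `S` of that function of the height, since the
projection to the base does not increase `(n-1)`-dimensional measure. -/
theorem setLIntegral_le_of_graph_subset {S : Set (Ambient n)} {P : Set (Horo n)}
    (m : Horo n → ℝ) (hS : ∀ x ∈ P, WithLp.toLp 2 (x, m x) ∈ S) {g : ℝ → ℝ≥0∞}
    (hg : Measurable g) :
    ∫⁻ x in P, g (m x) ≤ ∫⁻ p in S, g p.snd ∂μHE[n - 1] := by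
  set G : Set (Ambient n) := (fun x => WithLp.toLp 2 (x, m x)) '' P with hG
  have hle : volume.restrict P ≤ (μHE[n - 1].restrict G).map WithLp.fst := by
    refine Measure.le_iff.2 fun B hB => ?_
    rw [Measure.map_apply measurable_fst hB, Measure.restrict_apply hB,
      Measure.restrict_apply (measurable_fst hB)]
    refine (measure_mono ?_).trans (volume_image_fst_le _)
    rintro x ⟨hxB, hxP⟩
    exact ⟨_, ⟨hxB, x, hxP, rfl⟩, rfl⟩
  calc ∫⁻ x in P, g (m x)
      ≤ ∫⁻ x, g (m x) ∂(μHE[n - 1].restrict G).map WithLp.fst := lintegral_mono' hle le_rfl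
    _ ≤ ∫⁻ p in G, g (m p.fst) ∂μHE[n - 1] := lintegral_map_le (fun x => g (m x)) WithLp.fst
    _ ≤ ∫⁻ p in G, g p.snd ∂μHE[n - 1] := by
        refine setLIntegral_mono (hg.comp measurable_snd) ?_
        rintro _ ⟨x, -, rfl⟩
        exact le_rfl
    _ ≤ ∫⁻ p in S, g p.snd ∂μHE[n - 1] :=
        lintegral_mono_set (by rintro _ ⟨x, hx, rfl⟩; exact hS x hx)

/-! ### The isoperimetric inequality -/

/-- The isoperimetric inequality of the cusp: above a point `x` of the base, the domain lies above
its lowest boundary point `(x, m x)`, so that `(n-1) ∫ y⁻ⁿ dy ≤ (m x)¹⁻ⁿ`. -/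
theorem mul_riemannianVolume_le (hn : 2 ≤ n) {D : Set (Cusp L)} (hD : IsSmoothDomain L D) :
    ENNReal.ofReal ((n : ℝ) - 1) * riemannianVolume L n D
      ≤ riemannianVolume L (n - 1) (frontier D) := by
  have hn1 : (0 : ℝ) < (n : ℝ) - 1 := by
    have : (2 : ℝ) ≤ n := by exact_mod_cast hn
    linarith
  have hopen := isOpen_lift L hD.isOpen
  have hcont (x : Horo n) : Continuous fun y : ℝ => (WithLp.toLp 2 (x, y) : Ambient n) :=
    (WithLp.prod_continuous_toLp 2 _ _).comp (by fun_prop)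
  obtain ⟨ε, hε, hεD⟩ := exists_pos_le_snd_of_isCompact L hD.isCompact_closure
  set V : Horo n → Set ℝ := fun x => {y | 0 < y ∧ WithLp.toLp 2 (x, y) ∈ lift L D} with hV
  set m : Horo n → ℝ := fun x => sInf (V x)
  set P : Set (Horo n) := {x | (V x).Nonempty} with hP
  have hsub : lift L D ⊆ lift L (closure D) := Set.image_mono (Set.preimage_mono subset_closure)
  have hVε (x) : ∀ y ∈ V x, ε ≤ y := fun y hy => hεD _ (hsub hy.2)
  have hbdd (x) : BddBelow (V x) := ⟨ε, hVε x⟩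
  have hmpos : ∀ x ∈ P, 0 < m x := fun x hx => hε.trans_le (le_csInf hx (hVε x))
  have hVopen (x) : IsOpen (V x) := isOpen_Ioi.inter (hopen.preimage (hcont x))
  have hPmeas : MeasurableSet P := by
    have : P = ⋃ y ∈ Set.Ioi (0 : ℝ),
        (fun x : Horo n => (WithLp.toLp 2 (x, y) : Ambient n)) ⁻¹' lift L D := by
      ext x
      simp [hP, hV, Set.Nonempty]
    rw [this]
    refine (isOpen_biUnion fun y _ => hopen.preimage ?_).measurableSet
    exact (WithLp.prod_continuous_toLp 2 _ _).comp (by fun_prop)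
  have hmfr : ∀ x ∈ P, WithLp.toLp 2 (x, m x) ∈ lift L (frontier D) := by
    intro x hx
    rw [lift_frontier, hopen.frontier_eq]
    refine ⟨hmpos x hx, ?_, ?_⟩
    · have hmaps : Set.MapsTo (fun y : ℝ => (WithLp.toLp 2 (x, y) : Ambient n)) (V x) (lift L D) :=
        fun y hy => hy.2
      exact map_mem_closure (f := fun y : ℝ => (WithLp.toLp 2 (x, y) : Ambient n)) (hcont x)
        (csInf_mem_closure hx (hbdd x)) hmaps
    · intro hmem
      -- an open set of reals does not contain its infimum
      have h1 : V x ∈ 𝓝 (m x) := (hVopen x).mem_nhds ⟨hmpos x hx, hmem⟩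
      obtain ⟨l, hl, hlV⟩ := exists_Ioc_subset_of_mem_nhds h1 (exists_lt _)
      have h2 := csInf_le (hbdd x) (hlV (show (l + m x) / 2 ∈ _ by constructor <;> linarith))
      change m x ≤ _ at h2
      linarith
  have hfib : ∀ x, ENNReal.ofReal ((n : ℝ) - 1) * ∫⁻ y in V x, ENNReal.ofReal ((y ^ n)⁻¹)
      ≤ P.indicator (fun x => ENNReal.ofReal ((m x ^ (n - 1))⁻¹)) x := by
    intro x
    by_cases hx : x ∈ P
    · rw [Set.indicator_of_mem hx]
      have h1 : ∫⁻ y in V x, ENNReal.ofReal ((y ^ n)⁻¹)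
          ≤ ENNReal.ofReal ((m x ^ (n - 1))⁻¹ / ((n : ℝ) - 1)) := by
        rw [← lintegral_Ioi_inv_pow hn (hmpos x hx), setLIntegral_congr Ioi_ae_eq_Ici]
        exact lintegral_mono_set fun y hy => csInf_le (hbdd x) hy
      refine (mul_le_mul_right h1 _).trans_eq ?_
      rw [← ENNReal.ofReal_mul hn1.le, mul_div_cancel₀ _ hn1.ne']
    · rw [Set.not_nonempty_iff_eq_empty.1 hx]
      simp
  rw [riemannianVolume_of_isOpen L (by omega) hD.isOpen,
    riemannianVolume_frontier L (by omega) hD,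
    setLIntegral_inter_fundDomain L hopen.measurableSet
      (g := fun y => ENNReal.ofReal ((y ^ n)⁻¹)) (by fun_prop),
    ← lintegral_const_mul' _ _ ENNReal.ofReal_ne_top]
  calc _ ≤ ∫⁻ x in latticeCell L, P.indicator (fun x => ENNReal.ofReal ((m x ^ (n - 1))⁻¹)) x :=
        lintegral_mono hfib
    _ = ∫⁻ x in P ∩ latticeCell L, ENNReal.ofReal ((m x ^ (n - 1))⁻¹) := by
        rw [lintegral_indicator hPmeas, Measure.restrict_restrict hPmeas]
    _ ≤ _ := setLIntegral_le_of_graph_subset m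
        (S := lift L (frontier D) ∩ fundDomain L)
        (fun x hx => ⟨hmfr x hx.1, hx.2, hmpos x hx.1⟩)
        (g := fun y => ENNReal.ofReal ((y ^ (n - 1))⁻¹)) (by fun_prop)

end

section

variable {n : ℕ}

/-! ### Slabs, which almost attain the infimum -/

/-- The part of the cusp between the horospheres of heights `a` and `b`. -/
def slab (L : Submodule ℤ (Horo n)) (a b : ℝ) : Set (Cusp L) := height L ⁻¹' Set.Ioo a b

variable (L : Submodule ℤ (Horo n)) {a b : ℝ}

theorem mem_lift_slab (ha : 0 < a) {p : Ambient n} :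
    p ∈ lift L (slab L a b) ↔ a < p.snd ∧ p.snd < b := by
  rw [mem_lift]
  exact ⟨fun ⟨_, h⟩ => h, fun h => ⟨ha.trans h.1, h⟩⟩

theorem isOpen_slab : IsOpen (slab L a b) := isOpen_Ioo.preimage (continuous_height L)

theorem lift_frontier_slab_subset (hab : a < b) :
    lift L (frontier (slab L a b)) ⊆ {p | p.snd = a} ∪ {p | p.snd = b} := by
  rintro _ ⟨p, hp, rfl⟩
  have h := (continuous_height L).frontier_preimage_subset _ hp
  rw [frontier_Ioo hab] at h
  exact h

theorem snd_eq_innerSL :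
    (WithLp.snd : Ambient n → ℝ) = innerSL ℝ (WithLp.toLp 2 (0, 1) : Ambient n) := by
  ext q
  simp [WithLp.prod_inner_apply]

theorem fderiv_innerSL_ne_zero {E : Type*} [NormedAddCommGroup E] [InnerProductSpace ℝ E]
    {e : E} (he : e ≠ 0) (p : E) : fderiv ℝ (innerSL ℝ e) p ≠ 0 := by
  rw [ContinuousLinearMap.fderiv]
  intro h0
  have h1 : inner ℝ e e = 0 := DFunLike.congr_fun h0 e
  exact he (inner_self_eq_zero.1 h1)

theorem fderiv_snd_ne_zero (p : Ambient n) : fderiv ℝ (WithLp.snd : Ambient n → ℝ) p ≠ 0 := by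
  rw [snd_eq_innerSL]
  refine fderiv_innerSL_ne_zero (fun h => ?_) p
  simpa using congrArg WithLp.snd h

theorem contDiff_snd : ContDiff ℝ ∞ (WithLp.snd : Ambient n → ℝ) := by
  rw [snd_eq_innerSL]
  exact ContinuousLinearMap.contDiff _

theorem hasSmoothBoundary_slab (ha : 0 < a) (hab : a < b) :
    HasSmoothBoundary L (slab L a b) := by
  intro p hp
  have hc : ContinuousAt (WithLp.snd : Ambient n → ℝ) p :=
    (WithLp.continuous_snd 2 _ _).continuousAt
  rcases lift_frontier_slab_subset L hab hp with h | h
  · refine ⟨fun q => a - q.snd, contDiff_const.sub contDiff_snd, ?_, ?_⟩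
    · rw [fderiv_const_sub, neg_ne_zero]
      exact fderiv_snd_ne_zero p
    · filter_upwards [hc.eventually_lt_const (show p.snd < b from h.trans_lt hab)] with q hq
      rw [mem_lift_slab L ha, sub_neg]
      exact and_iff_left hq
  · refine ⟨fun q => q.snd - b, contDiff_snd.sub contDiff_const, ?_, ?_⟩
    · rw [fderiv_sub_const]
      exact fderiv_snd_ne_zero p
    · filter_upwards [hc.eventually_const_lt (show a < p.snd from hab.trans_eq h.symm)] with q hq
      rw [mem_lift_slab L ha, sub_neg]
      exact and_iff_right hq

variable [DiscreteTopology L] [IsZLattice ℝ L]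

theorem isCompact_preimage_height_Icc (ha : 0 < a) : IsCompact (height L ⁻¹' Set.Icc a b) := by
  set K : Set (Ambient n) := WithLp.toLp 2 '' (closure (latticeCell L) ×ˢ Set.Icc a b) with hK
  have hKc : IsCompact K :=
    ((isBounded_latticeCell L).isCompact_closure.prod isCompact_Icc).image
      (WithLp.prod_continuous_toLp 2 _ _)
  have hKs : K ⊆ Set.range (Subtype.val : UpperHalfSpace n → Ambient n) := by
    rintro _ ⟨⟨x, y⟩, hxy, rfl⟩
    exact ⟨⟨_, ha.trans_le hxy.2.1⟩, rfl⟩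
  have hKp : IsCompact ((Subtype.val : UpperHalfSpace n → Ambient n) ⁻¹' K) :=
    (IsInducing.subtypeVal.isCompact_preimage_iff hKs).2 hKc
  refine (hKp.image (continuous_proj L)).of_isClosed_subset
    (isClosed_Icc.preimage (continuous_height L)) fun x hx => ?_
  obtain ⟨p, ⟨hp, rfl⟩, -⟩ := existsUnique_mem_fundDomain L x
  exact ⟨p, ⟨(p.1.fst, p.1.snd), ⟨subset_closure hp.1, hx⟩, rfl⟩, rfl⟩

theorem isSmoothDomain_slab (ha : 0 < a) (hab : a < b) : IsSmoothDomain L (slab L a b) where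
  isOpen := isOpen_slab L
  isCompact_closure := (isCompact_preimage_height_Icc L ha).of_isClosed_subset isClosed_closure
    (closure_minimal (Set.preimage_mono Set.Ioo_subset_Icc_self)
      (isClosed_Icc.preimage (continuous_height L)))
  hasSmoothBoundary := hasSmoothBoundary_slab L ha hab

theorem riemannianVolume_slab (hn : 2 ≤ n) (ha : 0 < a) (hab : a < b) :
    riemannianVolume L n (slab L a b) = ENNReal.ofReal
      (((a ^ (n - 1))⁻¹ - (b ^ (n - 1))⁻¹) / ((n : ℝ) - 1) * (volume (latticeCell L)).toReal) := by
  have hn1 : (0 : ℝ) < (n : ℝ) - 1 := by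
    have : (2 : ℝ) ≤ n := by exact_mod_cast hn
    linarith
  have hb := ha.trans hab
  have hset (x : Horo n) : {y : ℝ | 0 < y ∧ WithLp.toLp 2 (x, y) ∈ lift L (slab L a b)}
      = Set.Ioo a b := by
    ext y
    simp only [Set.mem_ofPred_eq, mem_lift_slab L ha, Set.mem_Ioo]
    exact ⟨fun h => h.2, fun h => ⟨ha.trans h.1, h⟩⟩
  have hIoo : ∫⁻ y in Set.Ioo a b, ENNReal.ofReal ((y ^ n)⁻¹)
      = ENNReal.ofReal (((a ^ (n - 1))⁻¹ - (b ^ (n - 1))⁻¹) / ((n : ℝ) - 1)) := by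
    have h1 : ∫⁻ y in Set.Ioi a, ENNReal.ofReal ((y ^ n)⁻¹)
        = (∫⁻ y in Set.Ioc a b, ENNReal.ofReal ((y ^ n)⁻¹))
          + ∫⁻ y in Set.Ioi b, ENNReal.ofReal ((y ^ n)⁻¹) := by
      rw [← lintegral_union measurableSet_Ioi Set.Ioc_disjoint_Ioi_same,
        Set.Ioc_union_Ioi_eq_Ioi hab.le]
    rw [lintegral_Ioi_inv_pow hn ha, lintegral_Ioi_inv_pow hn hb] at h1
    rw [setLIntegral_congr Ioo_ae_eq_Ioc, sub_div, ENNReal.ofReal_sub _ (by positivity), h1,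
      ENNReal.add_sub_cancel_right ENNReal.ofReal_ne_top]
  rw [riemannianVolume_of_isOpen L (by omega) (isOpen_slab L),
    setLIntegral_inter_fundDomain L (isOpen_lift L (isOpen_slab L)).measurableSet
      (g := fun y => ENNReal.ofReal ((y ^ n)⁻¹)) (by fun_prop)]
  simp_rw [hset, hIoo]
  rw [setLIntegral_const, ENNReal.ofReal_mul' ENNReal.toReal_nonneg,
    ENNReal.ofReal_toReal (volume_latticeCell_ne_top L)]

/-- The compact horosphere at height `c` has the Euclidean area of a cell of the lattice, since
`x ↦ (x, c)` is an isometry. -/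
theorem setLIntegral_horosphere_le (c : ℝ) (g : ℝ → ℝ≥0∞) :
    ∫⁻ p in {p | p.snd = c} ∩ fundDomain L, g p.snd ∂μHE[n - 1]
      ≤ g c * volume (latticeCell L) := by
  have hiso : Isometry fun x : Horo n => (WithLp.toLp 2 (x, c) : Ambient n) :=
    Isometry.of_dist_eq fun x y => by
      rw [WithLp.prod_dist_eq_of_L2]
      simp
  have hms : MeasurableSet ({p : Ambient n | p.snd = c} ∩ fundDomain L) :=
    (measurable_snd (measurableSet_singleton c)).inter (measurableSet_fundDomain L)
  rw [setLIntegral_congr_fun (g := fun _ => g c) hms fun p hp => congrArg g hp.1,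
    setLIntegral_const]
  gcongr
  rw [← EuclideanSpace.euclideanHausdorffMeasure_eq_volume,
    ← hiso.euclideanHausdorffMeasure_image]
  refine measure_mono fun p hp => ⟨p.fst, hp.2.1, ?_⟩
  rw [← show p.snd = c from hp.1]
  rfl

theorem riemannianVolume_frontier_slab_le (hn : 2 ≤ n) (ha : 0 < a) (hab : a < b) :
    riemannianVolume L (n - 1) (frontier (slab L a b)) ≤ ENNReal.ofReal
      (((a ^ (n - 1))⁻¹ + (b ^ (n - 1))⁻¹) * (volume (latticeCell L)).toReal) := by
  have hb := ha.trans hab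
  rw [riemannianVolume_frontier L (by omega) (isSmoothDomain_slab L ha hab),
    ENNReal.ofReal_mul (by positivity), ENNReal.ofReal_toReal (volume_latticeCell_ne_top L),
    ENNReal.ofReal_add (by positivity) (by positivity), add_mul]
  refine (lintegral_mono_set (Set.inter_subset_inter_left _
    (lift_frontier_slab_subset L hab))).trans ?_
  rw [Set.union_inter_distrib_right]
  exact (lintegral_union_le _ _ _).trans (add_le_add
    (setLIntegral_horosphere_le L a fun y => ENNReal.ofReal ((y ^ (n - 1))⁻¹))
    (setLIntegral_horosphere_le L b fun y => ENNReal.ofReal ((y ^ (n - 1))⁻¹)))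

end

end HyperbolicCusp

theorem mainTheorem7 (n : ℕ) (hn : 2 ≤ n)
    (L : Submodule ℤ (HyperbolicCusp.Horo n)) [DiscreteTopology L] [IsZLattice ℝ L]
    (v : ℝ) (hv : 0 < v) :
    HyperbolicCusp.isoperimetricProfile L v = ENNReal.ofReal (((n : ℝ) - 1) * v) := by
  have hn1 : (0 : ℝ) < (n : ℝ) - 1 := by
    have : (2 : ℝ) ≤ n := by exact_mod_cast hn
    linarith
  apply le_antisymm
  · refine ENNReal.le_of_forall_pos_le_add fun ε hε _ => ?_
    set A : ℝ := (volume (HyperbolicCusp.latticeCell L)).toReal with hA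
    have hApos : 0 < A := ENNReal.toReal_pos (HyperbolicCusp.volume_latticeCell_ne_zero L)
      (HyperbolicCusp.volume_latticeCell_ne_top L)
    -- for every `s > 0` there is a height `c > 0` with `c¹⁻ⁿ = s`
    have hroot : ∀ s : ℝ, 0 < s → ∃ c : ℝ, 0 < c ∧ (c ^ (n - 1))⁻¹ = s := fun s hs =>
      ⟨s⁻¹ ^ (((n - 1 : ℕ) : ℝ)⁻¹), by positivity, by
        rw [Real.rpow_inv_natCast_pow (by positivity) (by omega), inv_inv]⟩
    -- the upper horosphere has area `t A = ε / 2`; the lower one is then fixed by the volume `v`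
    set t : ℝ := ε / (2 * A) with ht
    have htpos : 0 < t := by positivity
    obtain ⟨b, hb, hbt⟩ := hroot t htpos
    obtain ⟨a, ha, hat⟩ := hroot (t + ((n : ℝ) - 1) * v / A) (by positivity)
    have hab : a < b := by
      have h1 : (b ^ (n - 1))⁻¹ < (a ^ (n - 1))⁻¹ := by
        rw [hbt, hat]
        exact lt_add_of_pos_right _ (by positivity)
      exact lt_of_pow_lt_pow_left₀ (n - 1) hb.le ((inv_lt_inv₀ (by positivity) (by positivity)).1 h1)
    refine (iInf₂_le_of_le (HyperbolicCusp.slab L a b)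
      (HyperbolicCusp.isSmoothDomain_slab L ha hab) (iInf_le_of_le ?_
        (HyperbolicCusp.riemannianVolume_frontier_slab_le L hn ha hab))).trans_eq ?_
    · rw [HyperbolicCusp.riemannianVolume_slab L hn ha hab, hat, hbt, ← hA]
      congr 1
      field_simp
      ring
    · rw [← ENNReal.ofReal_coe_nnreal, ← ENNReal.ofReal_add (by positivity) (by positivity),
        hat, hbt, ← hA, ht]
      congr 1
      field_simp
      ring
  · refine le_iInf fun D => le_iInf fun hD => le_iInf fun hvol => ?_
    rw [ENNReal.ofReal_mul hn1.le, ← hvol]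
    exact HyperbolicCusp.mul_riemannianVolume_le L hn hD
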